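/- Notation. Let $N\ge 0$, $p\ge 1$, $q\ge 0$ be integers, and let $\mathbb B_N$ be the open unit ball of $\mathbb C^N$, with points written as row vectors and $\langle\lambda,\mu\rangle=\lambda\mu^*$. For a set $X$ and a function $k:X\times X\to\mathbb C$, a function $s:X\to\mathbb C^{a\times b}$ is called a Schur multiplier for $k$ if $(I_a-s(z)s(w)^*)\,k(z,w)$ is a positive kernel on $X$, i.e. $\sum_{i,j}u_i^*(I_a-s(z_i)s(z_j)^*)k(z_i,z_j)u_j\ge0$ for all finite families $z_i\in X$, $u_i\in\mathbb C^a$. For $\alpha,\lambda\in\mathbb B_N$ put $$b_\alpha(\lambda)=\frac{(1-\langle\alpha,\alpha\rangle)^{1/2}}{1-\langle\lambda,\alpha\rangle}\,(\lambda-\alpha)(I_N-\alpha^*\alpha)^{-1/2}\in\mathbb C^{1\times N}.$$ Theorem. Let $\Omega$ be a set (for instance an open subset of the open unit ball), let $\beta:\Omega\to\mathbb B_N$ be any map, and let $S:\Omega\to\mathbb C^{p\times q}$ be a Schur multiplier for $$K_\beta(z,w)=\frac1{1-\langle\beta(z),\beta(w)\rangle}.$$ Let $w_0\in\Omega$ and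 $\xi\in\mathbb C^p$ satisfy $\xi^*S(w_0)S(w_0)^*\xi<\xi^*\xi$, and put $\eta=S(w_0)^*\xi\in\mathbb C^q$, $\kappa=\xi^*\xi-\eta^*\eta>0$ and $D=\left(I_q+\frac{\eta\eta^*}{\kappa}\right)^{1/2}$. Then the following hold. 1. There is a $\mathbb C^{p\times q}$-valued Schur multiplier $G$ for the Drury–Arveson kernel $\frac1{1-\langle\lambda,\mu\rangle}$ on $\mathbb B_N$ such that $S(z)=G(\beta(z))$ for all $z\in\Omega$. 2. Let $U$ be any unitary $p\times p$ matrix whose last column is $\xi/\sqrt{\xi^*\xi}$, and let $U'\in\mathbb C^{p\times(p-1)}$ consist of its first $p-1$ columns. Then there is a (in general not unique) $\mathbb C^{(N+p-1)\times q}$-valued Schur multiplier $s_{\beta(w_0)}$ for the Drury–Arveson kernel on $\mathbb B_N$, whose composition $s_{\beta(w_0)}\circ\beta$ is a Schur multiplier for $K_\beta$, such that for all $z\in\Omega$ the inverse in the following formula exists and $$S(z)=\left(\begin{pmatrix}\frac{\xi\, b_{\beta(w_0)}(\beta(z))}{\sqrt{\kappa}}&U'\end{pmatrix}s_{\beta(w_0)}(\beta(z))+\frac{\xi\eta^*}{\kappa}D^{-1}\right)\left(\begin{pmatrix}\frac{\eta\,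 b_{\beta(w_0)}(\beta(z))}{\sqrt{\kappa}}&0\end{pmatrix}s_{\beta(w_0)}(\beta(z))+D\right)^{-1}.$$ 3. For all $z\in\Omega$, with Euclidean norms of row vectors, $$\left\|(\xi^*S(z)-\eta^*)\,D\right\|\le\frac{|\xi^*\xi-\xi^*S(z)\eta|}{\sqrt{\kappa}}\;\|b_{\beta(w_0)}(\beta(z))\|.$$ -/

import Mathlib

open scoped ComplexOrder MatrixOrder

noncomputable section

/-- A matrix-valued function `K` on `X × X` is a positive kernel if
`∑ i j, uᵢ* K(xᵢ, xⱼ) uⱼ ≥ 0` for all finite families of points `xᵢ` and vectors `uᵢ`. -/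
def IsPositiveKernel {X m : Type*} [Fintype m] (K : X → X → Matrix m m ℂ) : Prop :=
  ∀ (n : ℕ) (x : Fin n → X) (u : Fin n → m → ℂ),
    0 ≤ ∑ i, ∑ j, star (u i) ⬝ᵥ (K (x i) (x j)).mulVec (u j)

/-- `s` is a Schur multiplier of the reproducing kernel Hilbert space with kernel `k`:
`(I - s(z) s(w)*) k(z, w)` is a positive kernel. -/
def IsSchurMultiplier {X m n : Type*} [Fintype m] [DecidableEq m] [Fintype n]
    (k : X → X → ℂ) (s : X → Matrix m n ℂ) : Prop :=
  IsPositiveKernel fun z w => k z w • (1 - s z * (s w).conjTranspose)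

/-- The open unit ball of `ℂ^N` (Euclidean norm). -/
abbrev OpenBall (N : ℕ) : Type :=
  Metric.ball (0 : EuclideanSpace ℂ (Fin N)) 1

/-- The Drury-Arveson kernel `1 / (1 - ⟨l, μ⟩)` on the ball, `⟨l, μ⟩ = ∑ lᵢ conj μᵢ`
(Mathlib's `inner` is conjugate linear in its first argument). -/
def druryArveson (N : ℕ) (l μ : OpenBall N) : ℂ :=
  1 / (1 - inner ℂ (μ : EuclideanSpace ℂ (Fin N)) (l : EuclideanSpace ℂ (Fin N)))

/-- The kernel `K_β(z, w) = 1 / (1 - ⟨β(z), β(w)⟩)`. -/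
def kernelBeta {Ω : Type*} {N : ℕ} (β : Ω → OpenBall N) (z w : Ω) : ℂ :=
  1 / (1 - inner ℂ (β w : EuclideanSpace ℂ (Fin N)) (β z : EuclideanSpace ℂ (Fin N)))

/-- The Blaschke factor
`b_a(l) = (1 - ⟨a, a⟩)^(1/2) / (1 - ⟨l, a⟩) • (l - a) (I_N - a* a)^(-1/2)`;
points of the ball are row vectors, so `a* a` is the matrix `(conj aᵢ * aⱼ)`. -/
def blaschke {N : ℕ} (a l : OpenBall N) : EuclideanSpace ℂ (Fin N) :=
  WithLp.toLp 2
    (((Real.sqrt (1 - ‖(a : EuclideanSpace ℂ (Fin N))‖ ^ 2) : ℝ) /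
        (1 - inner ℂ (a : EuclideanSpace ℂ (Fin N)) (l : EuclideanSpace ℂ (Fin N))) : ℂ) •
      Matrix.vecMul (l.1 - a.1).ofLp
        (CFC.sqrt (1 - Matrix.vecMulVec (star a.1.ofLp) a.1.ofLp))⁻¹)

/-- `c* J_{p,q} c = ξ*ξ - η*η`, where `c = (ξ, η)` and `J_{p,q} = diag(I_p, -I_q)`. -/
def cJc {p q : ℕ} (ξ : Fin p → ℂ) (η : Fin q → ℂ) : ℝ :=
  (star ξ ⬝ᵥ ξ - star η ⬝ᵥ η).re

/-- The `q × q` matrix `(I_q + ηη* / (c* J_{p,q} c))^(1/2)`. -/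
def rootD {p q : ℕ} (ξ : Fin p → ℂ) (η : Fin q → ℂ) : Matrix (Fin q) (Fin q) ℂ :=
  CFC.sqrt (1 + ((cJc ξ η : ℝ) : ℂ)⁻¹ • Matrix.vecMulVec η (star η))

/-- The numerator of the linear fractional transformation, with `p = r + 1`:
`(ξ b / √(c*Jc), U') σ + (ξη* / (c*Jc)) (I_q + ηη* / (c*Jc))^(-1/2)`,
where `U'` consists of the first `p - 1` columns of `U`. -/
def lftNum {N r q : ℕ} (ξ : Fin (r + 1) → ℂ) (η : Fin q → ℂ)
    (U : Matrix (Fin (r + 1)) (Fin (r + 1)) ℂ) (b : EuclideanSpace ℂ (Fin N))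
    (σ : Matrix (Fin N ⊕ Fin r) (Fin q) ℂ) : Matrix (Fin (r + 1)) (Fin q) ℂ :=
  Matrix.fromCols (((Real.sqrt (cJc ξ η) : ℝ) : ℂ)⁻¹ • Matrix.vecMulVec ξ b.ofLp)
      (U.submatrix id Fin.castSucc) * σ
    + (((cJc ξ η : ℝ) : ℂ)⁻¹ • Matrix.vecMulVec ξ (star η)) * (rootD ξ η)⁻¹

/-- The denominator of the linear fractional transformation, with `p = r + 1`:
`(η b / √(c*Jc), 0) σ + (I_q + ηη* / (c*Jc))^(1/2)`. -/
def lftDen {N r q : ℕ} (ξ : Fin (r + 1) → ℂ) (η : Fin q → ℂ) (b : EuclideanSpace ℂ (Fin N))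
    (σ : Matrix (Fin N ⊕ Fin r) (Fin q) ℂ) : Matrix (Fin q) (Fin q) ℂ :=
  Matrix.fromCols (((Real.sqrt (cJc ξ η) : ℝ) : ℂ)⁻¹ • Matrix.vecMulVec η b.ofLp)
      (0 : Matrix (Fin q) (Fin r) ℂ) * σ
    + rootD ξ η

/-- `U` is a unitary `p × p` matrix (`p = r + 1`) whose last column is `ξ / √(ξ*ξ)`. -/
def IsAdaptedUnitary {r : ℕ} (ξ : Fin (r + 1) → ℂ)
    (U : Matrix (Fin (r + 1)) (Fin (r + 1)) ℂ) : Prop :=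
  U ∈ Matrix.unitaryGroup (Fin (r + 1)) ℂ ∧
    U.col (Fin.last r) = ((Real.sqrt (star ξ ⬝ᵥ ξ).re : ℝ) : ℂ)⁻¹ • ξ

end

/-! Everything reduces to one Leech-type factorization, `exists_schurMultiplier_mul_eq`. If
`K_β(z,w)(T(z)T(w)* - R(z)R(w)*)` is positive, write it as a Gram matrix; the two sides of the
resulting identity are Gram matrices of two families, so a contraction `V` carries one family to the
other, and its transfer function `s` solves `T·(s∘β) = R`. Taking `T = 1`, `R = S` gives the
extension `G`.

For the linear fractional formula, take the Schur complement of `K_β(z,w)(1 - S(z)S(w)*)` at `(w₀,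
ξ)`. By the Blaschke identity it equals `K_β(z,w)` times `1 - S(z)S(w)* - κ⁻¹(1 - ⟨b(z),b(w)⟩)(ξ -
S(z)η)(ξ - S(w)η)*`, with `b = b_{β(w₀)}∘β` (`isPositiveKernel_sub_rankOne`). The bracket factors as
`T T* - R R*` with `T = leechLeft`, `R = leechRight`, and `T·s = R` is the formula with its
denominator cleared; `isUnit_lftDen` permits the division. The norm estimate is the positivity of
the same kernel at one point in the direction `ξ`. -/

open scoped InnerProductSpace

/-! ### Positive semidefinite matrices over arbitrary index sets -/

namespace Matrix

/-- A matrix with arbitrary index type is positive semidefinite as soon as all the finite matrices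
sampled from it (with possible repetitions) have nonnegative entry sums after rescaling. -/
theorem PosSemidef.of_fin_sum_nonneg {X : Type*} {M : Matrix X X ℂ}
    (h : ∀ (n : ℕ) (x : Fin n → X) (c : Fin n → ℂ),
      0 ≤ ∑ i, ∑ j, star (c i) * M (x i) (x j) * c j) : M.PosSemidef := by
  refine ⟨?_, fun c => ?_⟩
  -- Polarization: the vectors `(1)`, `(1, 1)` and `(1, I)` recover the Hermitian symmetry from
  -- reality of the sums.
  · ext i j
    have h1 := (Complex.nonneg_iff.1 (h 1 ![i] ![1])).2
    have h2 := (Complex.nonneg_iff.1 (h 1 ![j] ![1])).2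
    have h3 := (Complex.nonneg_iff.1 (h 2 ![i, j] ![1, 1])).2
    have h4 := (Complex.nonneg_iff.1 (h 2 ![i, j] ![1, Complex.I])).2
    simp [Fin.sum_univ_two] at h1 h2 h3 h4
    apply Complex.ext <;> simp <;> linarith
  · have := h _ (fun i => (c.support.equivFin.symm i : X)) (fun i => c (c.support.equivFin.symm i))
    rw [Equiv.sum_comp c.support.equivFin.symm (fun i : c.support =>
      ∑ j, star (c i) * M i (c.support.equivFin.symm j) * c (c.support.equivFin.symm j))] at this
    simp_rw [fun i : c.support => Equiv.sum_comp c.support.equivFin.symm (fun j : c.support =>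
      star (c i) * M i j * c j)] at this
    rw [Finset.sum_coe_sort c.support (fun i => ∑ j : c.support, star (c i) * M i j * c j)] at this
    simp_rw [fun i => Finset.sum_coe_sort c.support (fun j => star (c i) * M i j * c j)] at this
    exact this

theorem PosSemidef.fin_sum_nonneg {X : Type*} {M : Matrix X X ℂ} (h : M.PosSemidef)
    {n : ℕ} (x : Fin n → X) (c : Fin n → ℂ) :
    0 ≤ ∑ i, ∑ j, star (c i) * M (x i) (x j) * c j := by
  have := (h.submatrix x).dotProduct_mulVec_nonneg c
  simpa [dotProduct, mulVec, Finset.mul_sum, mul_assoc] using this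

/-- Gram matrices with arbitrary index type are positive semidefinite. -/
theorem posSemidef_gram_of_type {X E : Type*} [NormedAddCommGroup E] [InnerProductSpace ℂ E]
    (v : X → E) : (gram ℂ v).PosSemidef :=
  .of_fin_sum_nonneg fun n x c => by
    have h := (posSemidef_gram ℂ (v ∘ x)).dotProduct_mulVec_nonneg c
    simpa [dotProduct, mulVec, Finset.mul_sum, mul_assoc] using h

theorem posSemidef_gram_sub_gram {X E F : Type*} [NormedAddCommGroup E] [InnerProductSpace ℂ E]
    [NormedAddCommGroup F] [InnerProductSpace ℂ F] (v : X → E) {f : E →L[ℂ] F} (hf : ‖f‖ ≤ 1) :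
    (gram ℂ v - gram ℂ (f ∘ v)).PosSemidef := by
  have h := (posSemidef_opNorm_smul_gram_sub_gram v f).add
    ((posSemidef_gram_of_type v).smul (a := 1 - ‖f‖ ^ 2)
      (sub_nonneg.2 (pow_le_one₀ (norm_nonneg f) hf)))
  have he : gram ℂ v - gram ℂ (f ∘ v) =
      ‖f‖ ^ 2 • gram ℂ v - gram ℂ (f ∘ v) + (1 - ‖f‖ ^ 2) • gram ℂ v := by
    ext i j
    simp
    ring
  rwa [he]

/-- Every positive semidefinite matrix is a Gram matrix in some Hilbert space. -/
theorem PosSemidef.exists_eq_gram.{u} {X : Type u} {M : Matrix X X ℂ} (hM : M.PosSemidef) :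
    ∃ (H : Type u) (_ : NormedAddCommGroup H) (_ : InnerProductSpace ℂ H) (_ : CompleteSpace H)
      (v : X → H), M = gram ℂ v := by
  let K : Matrix X X (ℂ →L[ℂ] ℂ) := of fun x y => M x y • ContinuousLinearMap.id ℂ ℂ
  have hK : K.PosSemidef := by
    refine ((RKHS.posSemidef_tfae (K := K)).out 0 1 rfl rfl).2 ⟨?_, fun f => ?_⟩
    · ext x y
      have h := hM.isHermitian.apply x y
      have hid : ContinuousLinearMap.adjoint (ContinuousLinearMap.id ℂ ℂ) =
        ContinuousLinearMap.id ℂ ℂ := ContinuousLinearMap.adjoint_id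
      simp only [RCLike.star_def] at h
      simp [K, ContinuousLinearMap.star_eq_adjoint, hid, h]
    -- Testing the operator kernel on pairs `(x, v)` gives the Schur product of `M` with the Gram
    -- matrix of the scalars `v`.
    · have h := hM.submatrix (fun xv : X × ℂ => xv.1)
      have h := ((h.hadamard (posSemidef_gram_of_type (fun xv : X × ℂ => xv.2))).2 f)
      rw [Complex.nonneg_iff] at h
      convert h.1 using 1
      have hs (i j) : (starRingEnd ℂ) (M j i) = M i j := hM.isHermitian.apply i j
      simp only [Finsupp.sum]
      refine congrArg _ (Finset.sum_congr rfl fun a _ => Finset.sum_congr rfl fun b _ => ?_)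
      simp [K, hs, -Complex.inner, mul_comm, mul_left_comm]
  have : Fact K.PosSemidef := ⟨hK⟩
  refine ⟨RKHS.OfKernel K, inferInstance, inferInstance, inferInstance,
    fun x => RKHS.kerFun (RKHS.OfKernel K) x 1, ?_⟩
  ext x y
  rw [gram_apply, ← RKHS.kernel_inner, RKHS.OfKernel.kernel_ofKernel]
  have := hM.isHermitian.apply x y
  simp only [RCLike.star_def] at this
  simp [K, this]

/-- The Schur complement of a diagonal entry is positive semidefinite. -/
theorem PosSemidef.schurComplement {X : Type*} {M : Matrix X X ℂ} (hM : M.PosSemidef) (e : X) :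
    (of fun i j => M i j - M i e * M e j / M e e).PosSemidef := by
  obtain ⟨H, _, _, _, v, rfl⟩ := hM.exists_eq_gram
  -- These vectors are the residuals of `v i` after projection onto the line of `v e`. If `v e = 0`,
  -- division by zero gives `0` on both sides.
  convert posSemidef_gram_of_type (fun i => v i - (⟪v e, v i⟫_ℂ / ⟪v e, v e⟫_ℂ) • v e) using 1
  ext i j
  simp only [of_apply, gram_apply, inner_sub_left, inner_sub_right, inner_smul_left,
    inner_smul_right, map_div₀, inner_conj_symm]
  by_cases h : ⟪v e, v e⟫_ℂ = 0
  · rw [h]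
    simp
  · field_simp
    ring

/-- If the entries of a positive semidefinite matrix have modulus less than one, then the matrix
with entries `1 / (1 - M i j)` is positive semidefinite. -/
theorem PosSemidef.one_div_one_sub {X : Type*} {M : Matrix X X ℂ} (hM : M.PosSemidef)
    (h1 : ∀ i j, ‖M i j‖ < 1) : (of fun i j => 1 / (1 - M i j)).PosSemidef := by
  -- Entrywise geometric series; each entrywise power is positive by the Schur product theorem.
  have hpow (k : ℕ) : (of fun i j => M i j ^ k).PosSemidef := by
    induction k with
    | zero =>
      convert posSemidef_gram_of_type (fun _ : X => (1 : ℂ)) using 1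
      ext i j; simp
    | succ k ih => exact ih.hadamard hM
  refine .of_fin_sum_nonneg fun n x c => ?_
  have hs : HasSum (fun k : ℕ => ∑ i, ∑ j, star (c i) * M (x i) (x j) ^ k * c j)
      (∑ i, ∑ j, star (c i) * (1 / (1 - M (x i) (x j))) * c j) := by
    refine hasSum_sum fun i _ => hasSum_sum fun j _ => ?_
    rw [one_div]
    exact ((hasSum_geometric_of_norm_lt_one (h1 _ _)).mul_left _).mul_right _
  exact hs.nonneg fun k => (hpow k).fin_sum_nonneg x c

end Matrix

/-! ### The lurking isometry and matrix kernels as scalar ones -/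

/-- Two families with the same Gram matrix are intertwined by a contraction. -/
theorem exists_contraction_of_gram_eq {X E F : Type*} [NormedAddCommGroup E]
    [InnerProductSpace ℂ E] [CompleteSpace E] [NormedAddCommGroup F] [InnerProductSpace ℂ F]
    [CompleteSpace F] (f : X → E) (g : X → F) (h : Matrix.gram ℂ f = Matrix.gram ℂ g) :
    ∃ V : E →L[ℂ] F, ‖V‖ ≤ 1 ∧ ∀ x, V (f x) = g x := by
  let Lf := Finsupp.linearCombination ℂ f
  let Lg := Finsupp.linearCombination ℂ g
  -- Equal Gram matrices make `f x ↦ g x` isometric on the span, hence well defined and extendable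
  -- to its closure `K`; precomposing with the projection onto `K` gives a map on all of `E`.
  have hn (c : X →₀ ℂ) : ‖Lg c‖ = ‖Lf c‖ := by
    have hin : ⟪Lg c, Lg c⟫_ℂ = ⟪Lf c, Lf c⟫_ℂ := by
      simp only [Lf, Lg, Finsupp.linearCombination_apply, Finsupp.sum_inner, Finsupp.inner_sum]
      simp only [inner_smul_left, inner_smul_right, ← Matrix.gram_apply, h]
    rw [@norm_eq_sqrt_re_inner ℂ, hin, ← norm_eq_sqrt_re_inner]
  let K := (LinearMap.range Lf).topologicalClosure
  let e : (X →₀ ℂ) →ₗ[ℂ] K :=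
    Lf.codRestrict K fun c => Submodule.le_topologicalClosure _ (LinearMap.mem_range_self Lf c)
  have hd : DenseRange e := by
    rw [DenseRange, Subtype.dense_iff]
    intro x hx
    have : ((↑) : K → E) '' Set.range e = Set.range Lf := by
      rw [← Set.range_comp]; rfl
    have hx' : x ∈ closure (((↑) : K → E) '' Set.range e) := by
      rw [this]
      exact hx
    exact hx'
  have hb (c : X →₀ ℂ) : ‖Lg c‖ ≤ 1 * ‖e c‖ := by
    rw [hn, one_mul]; rfl
  refine ⟨(Lg.extendOfNorm e).comp K.orthogonalProjectionOnto, ?_, fun x => ?_⟩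
  · grw [ContinuousLinearMap.opNorm_comp_le, LinearMap.opNorm_extendOfNorm_le hd zero_le_one hb,
      Submodule.orthogonalProjectionOnto_norm_le]
    norm_num
  · have hx : f x = (e (Finsupp.single x 1) : E) := by simp [e, Lf]
    rw [hx, ContinuousLinearMap.comp_apply, Submodule.orthogonalProjectionOnto_mem_subspace_eq_self,
      LinearMap.extendOfNorm_eq hd ⟨1, hb⟩]
    simp [Lg]

/-- The scalar matrix, indexed by pairs of a point and a vector, attached to a matrix kernel. -/
def kernelMatrix {X m : Type*} [Fintype m] (K : X → X → Matrix m m ℂ) :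
    Matrix (X × (m → ℂ)) (X × (m → ℂ)) ℂ :=
  Matrix.of fun a b => star a.2 ⬝ᵥ (K a.1 b.1).mulVec b.2

/-- Moving the test vectors into the index set makes the scalar results applicable; the scalar
coefficients are absorbed by rescaling those vectors. -/
theorem isPositiveKernel_iff {X m : Type*} [Fintype m] {K : X → X → Matrix m m ℂ} :
    IsPositiveKernel K ↔ (kernelMatrix K).PosSemidef := by
  constructor
  · intro h
    refine .of_fin_sum_nonneg fun n x c => ?_
    convert h n (fun i => (x i).1) (fun i => c i • (x i).2) using 4 with i _ j _
    simp [kernelMatrix, Matrix.mulVec_smul]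
    ring
  · intro h n x u
    simpa [kernelMatrix] using h.fin_sum_nonneg (fun i => (x i, u i)) (fun _ => 1)

theorem conjTranspose_mulVec_dotProduct_star {p n : Type*} [Fintype p] [Fintype n]
    (A B : Matrix p n ℂ) (u v : p → ℂ) :
    B.conjTranspose.mulVec v ⬝ᵥ star (A.conjTranspose.mulVec u) =
      star u ⬝ᵥ (A * B.conjTranspose).mulVec v := by
  rw [← Matrix.mulVec_mulVec, Matrix.dotProduct_mulVec, Matrix.star_mulVec,
    Matrix.conjTranspose_conjTranspose, dotProduct_comm]

namespace OpenBall

variable {N : ℕ}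

theorem norm_inner_lt_one (l m : OpenBall N) : ‖⟪l.1, m.1⟫_ℂ‖ < 1 := by
  have hl : ‖l.1‖ < 1 := mem_ball_zero_iff.1 l.2
  have hm : ‖m.1‖ < 1 := mem_ball_zero_iff.1 m.2
  calc ‖⟪l.1, m.1⟫_ℂ‖ ≤ ‖l.1‖ * ‖m.1‖ := norm_inner_le_norm _ _
    _ < 1 := by nlinarith [norm_nonneg l.1, norm_nonneg m.1]

theorem one_sub_inner_ne_zero (l m : OpenBall N) : 1 - ⟪l.1, m.1⟫_ℂ ≠ 0 := by
  intro h
  have := norm_inner_lt_one l m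
  rw [← sub_eq_zero.1 h] at this
  simp at this

end OpenBall

theorem posSemidef_druryArveson (N : ℕ) : (Matrix.of (druryArveson N)).PosSemidef :=
  ((Matrix.posSemidef_gram_of_type (fun l : OpenBall N => l.1)).transpose).one_div_one_sub
    fun l m => OpenBall.norm_inner_lt_one m l

/-! ### Transfer functions and Leech factorization -/

section Realization

variable {H : Type*} [NormedAddCommGroup H] [InnerProductSpace ℂ H] {N : ℕ}

/-- The column of scalar multiplications by the conjugate coordinates of a point. -/
def conjColumn (H : Type*) [NormedAddCommGroup H] [InnerProductSpace ℂ H] (l : OpenBall N) :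
    H →L[ℂ] PiLp 2 (fun _ : Fin N => H) :=
  (PiLp.continuousLinearEquiv 2 ℂ (fun _ : Fin N => H)).symm ∘L
    ContinuousLinearMap.pi fun i => star (l.1 i) • ContinuousLinearMap.id ℂ H

theorem inner_conjColumn (l m : OpenBall N) (x y : H) :
    ⟪conjColumn H l x, conjColumn H m y⟫_ℂ = ⟪m.1, l.1⟫_ℂ * ⟪x, y⟫_ℂ := by
  simp [conjColumn, PiLp.inner_apply, inner_smul_left, inner_smul_right, Finset.sum_mul,
    mul_assoc, mul_left_comm]

theorem norm_conjColumn (l : OpenBall N) (x : H) : ‖conjColumn H l x‖ = ‖l.1‖ * ‖x‖ := by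
  have h : ‖conjColumn H l x‖ ^ 2 = (‖l.1‖ * ‖x‖) ^ 2 := by
    have h := inner_conjColumn l l x x
    simp only [inner_self_eq_norm_sq_to_K] at h
    rw [mul_pow]
    exact_mod_cast h
  exact (sq_eq_sq₀ (norm_nonneg _) (by positivity)).1 h

variable [CompleteSpace H] {m q : Type*} [Fintype m] [Fintype q] [DecidableEq m]

-- The state equation reads `x = A x + B u` with `‖A‖ ≤ ‖l‖ < 1`, so `X = (1 - A)⁻¹ B`.
omit [DecidableEq m] in
theorem exists_state_map
    (V : WithLp 2 (PiLp 2 (fun _ : Fin N => H) × EuclideanSpace ℂ m) →L[ℂ]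
      WithLp 2 (H × EuclideanSpace ℂ q)) (hV : ‖V‖ ≤ 1) (l : OpenBall N) :
    ∃ X : EuclideanSpace ℂ m →L[ℂ] H, ∀ u x,
      (V (WithLp.toLp 2 (conjColumn H l x, u))).fst = x ↔ x = X u := by
  let e := WithLp.prodContinuousLinearEquiv 2 ℂ H (EuclideanSpace ℂ q)
  let e' := WithLp.prodContinuousLinearEquiv 2 ℂ (PiLp 2 (fun _ : Fin N => H)) (EuclideanSpace ℂ m)
  let V₁ := ContinuousLinearMap.fst ℂ _ _ ∘L e.toContinuousLinearMap ∘L V ∘L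
    e'.symm.toContinuousLinearMap
  let A : H →L[ℂ] H := V₁ ∘L ContinuousLinearMap.inl ℂ _ _ ∘L conjColumn H l
  let B := V₁ ∘L ContinuousLinearMap.inr ℂ (PiLp 2 (fun _ : Fin N => H)) (EuclideanSpace ℂ m)
  have hA : ‖A‖ < 1 := by
    refine lt_of_le_of_lt (A.opNorm_le_bound (norm_nonneg l.1) fun x => ?_) (mem_ball_zero_iff.1 l.2)
    calc ‖A x‖ ≤ ‖V (WithLp.toLp 2 (conjColumn H l x, 0))‖ :=
          WithLp.norm_fst_le _ _
      _ ≤ 1 * ‖WithLp.toLp 2 (conjColumn H l x, (0 : EuclideanSpace ℂ m))‖ := V.le_of_opNorm_le hV _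
      _ = ‖l.1‖ * ‖x‖ := by simp [norm_conjColumn]
  refine ⟨(Units.oneSub A hA)⁻¹.val ∘L B, fun u x => ?_⟩
  have hsplit : (V (WithLp.toLp 2 (conjColumn H l x, u))).fst = A x + B u := by
    have : V₁ (conjColumn H l x, u) = V₁ (conjColumn H l x, 0) + V₁ (0, u) := by
      rw [← map_add]; simp
    exact this
  have hmul (y : H) : ((Units.oneSub A hA)⁻¹.val) ((1 - A) y) = y :=
    DFunLike.congr_fun (Units.oneSub A hA).inv_mul y
  have hmul' (y : H) : (1 - A) (((Units.oneSub A hA)⁻¹.val) y) = y :=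
    DFunLike.congr_fun (Units.oneSub A hA).mul_inv y
  clear_value A B
  rw [hsplit, ContinuousLinearMap.comp_apply]
  constructor
  · intro h
    have h' : (1 - A) x = B u := by
      rw [sub_apply, one_apply_eq_self, sub_eq_iff_eq_add', h]
    rw [← h', hmul]
  · intro h
    have h' := hmul' (B u)
    rw [← h, sub_apply, one_apply_eq_self, sub_eq_iff_eq_add'] at h'
    exact h'.symm

/-- The transfer function of a contractive colligation is a Schur multiplier of the
Drury-Arveson space. -/
theorem exists_transferFunction
    (V : WithLp 2 (PiLp 2 (fun _ : Fin N => H) × EuclideanSpace ℂ m) →L[ℂ]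
      WithLp 2 (H × EuclideanSpace ℂ q)) (hV : ‖V‖ ≤ 1) :
    ∃ s : OpenBall N → Matrix m q ℂ, IsSchurMultiplier (druryArveson N) s ∧
      ∀ l x u y, V (WithLp.toLp 2 (conjColumn H l x, WithLp.toLp 2 u)) =
        WithLp.toLp 2 (x, WithLp.toLp 2 y) → y = (s l).conjTranspose.mulVec u := by
  choose X hX using exists_state_map V hV
  let ι (l : OpenBall N) (u : m → ℂ) : WithLp 2 (PiLp 2 (fun _ : Fin N => H) × EuclideanSpace ℂ m) :=
    WithLp.toLp 2 (conjColumn H l (X l (WithLp.toLp 2 u)), WithLp.toLp 2 u)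
  let L (l : OpenBall N) : (m → ℂ) →ₗ[ℂ] q → ℂ :=
    { toFun u := (V (ι l u)).snd.ofLp
      map_add' u v := by
        have : ι l (u + v) = ι l u + ι l v := by
          simp only [ι, WithLp.toLp_add, map_add, ← Prod.mk_add_mk]
        rw [this, map_add]; rfl
      map_smul' c u := by
        have : ι l (c • u) = c • ι l u := by
          simp only [ι, WithLp.toLp_smul, map_smul, ← Prod.smul_mk]
        rw [this, map_smul]; rfl }
  let s (l : OpenBall N) : Matrix m q ℂ := (LinearMap.toMatrix' (L l)).conjTranspose
  have hs (l u) : (s l).conjTranspose.mulVec u = (V (ι l u)).snd.ofLp := by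
    simp only [s, Matrix.conjTranspose_conjTranspose, LinearMap.toMatrix'_mulVec]
    rfl
  have hVι (l u) : V (ι l u) = WithLp.toLp 2
      (X l (WithLp.toLp 2 u), WithLp.toLp 2 ((s l).conjTranspose.mulVec u)) := by
    rw [hs]
    exact congrArg (WithLp.toLp 2) (Prod.ext ((hX l _ _).2 rfl) rfl)
  refine ⟨s, ?_, fun l x u y h => ?_⟩
  · rw [IsSchurMultiplier, isPositiveKernel_iff]
    -- Contractivity of `V` gives positivity of `u*(1 - s s*)v - (1 - ⟨l,μ⟩)⟪X u, X v⟫`. Multiplying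
    -- by the Drury-Arveson kernel and adding back the Gram matrix of the states leaves the required
    -- kernel.
    have h1 := Matrix.posSemidef_gram_sub_gram (fun a : OpenBall N × (m → ℂ) => ι a.1 a.2) hV
    have h2 := Matrix.posSemidef_gram_of_type
      (fun a : OpenBall N × (m → ℂ) => X a.1 (WithLp.toLp 2 a.2))
    have h3 := ((posSemidef_druryArveson N).submatrix (fun a : OpenBall N × (m → ℂ) => a.1)).hadamard
      h1 |>.add h2
    refine Eq.mpr (congrArg Matrix.PosSemidef ?_) h3
    ext a b
    have hk := OpenBall.one_sub_inner_ne_zero b.1 a.1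
    simp only [kernelMatrix, Matrix.of_apply, Matrix.add_apply, Matrix.hadamard_apply,
      Matrix.submatrix_apply, Matrix.sub_apply, Matrix.gram_apply, Function.comp_apply, hVι,
      WithLp.prod_inner_apply, inner_conjColumn, ι, druryArveson, Matrix.smul_mulVec,
      dotProduct_smul, smul_eq_mul, Matrix.sub_mulVec, Matrix.one_mulVec, dotProduct_sub,
      EuclideanSpace.inner_toLp_toLp]
    rw [conjTranspose_mulVec_dotProduct_star, dotProduct_comm (star a.2) b.2]
    field_simp
    ring
  · have hx := (hX l (WithLp.toLp 2 u) x).1 (congrArg WithLp.fst h)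
    subst hx
    rw [hs]
    exact (congrArg (fun w => w.snd.ofLp) h).symm

end Realization

/-- A Leech type factorization theorem: if `(T(z) T(w)* - R(z) R(w)*) / (1 - ⟨β(z), β(w)⟩)` is a
positive kernel, then `T s∘β = R` for some Drury-Arveson Schur multiplier `s`. -/
theorem exists_schurMultiplier_mul_eq {Ω p m q : Type*} [Fintype p] [Fintype m] [Fintype q]
    [DecidableEq m] {N : ℕ} (β : Ω → OpenBall N) (T : Ω → Matrix p m ℂ)
    (R : Ω → Matrix p q ℂ)
    (h : IsPositiveKernel fun z w =>
      kernelBeta β z w • (T z * (T w).conjTranspose - R z * (R w).conjTranspose)) :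
    ∃ s : OpenBall N → Matrix m q ℂ, IsSchurMultiplier (druryArveson N) s ∧
      ∀ z, T z * s (β z) = R z := by
  obtain ⟨H, _, _, _, v, hv⟩ := (isPositiveKernel_iff.1 h).exists_eq_gram
  let f (a : Ω × (p → ℂ)) : WithLp 2 (PiLp 2 (fun _ : Fin N => H) × EuclideanSpace ℂ m) :=
    WithLp.toLp 2 (conjColumn H (β a.1) (v a), WithLp.toLp 2 ((T a.1).conjTranspose.mulVec a.2))
  let g (a : Ω × (p → ℂ)) : WithLp 2 (H × EuclideanSpace ℂ q) :=
    WithLp.toLp 2 (v a, WithLp.toLp 2 ((R a.1).conjTranspose.mulVec a.2))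
  -- This is `hv` multiplied by `1 - ⟨β(z), β(w)⟩`, with the terms rearranged.
  have hfg : Matrix.gram ℂ f = Matrix.gram ℂ g := by
    ext a b
    have hk := OpenBall.one_sub_inner_ne_zero (β b.1) (β a.1)
    have hab := congrFun (congrFun hv a) b
    simp only [kernelMatrix, Matrix.of_apply, Matrix.gram_apply, kernelBeta, Matrix.smul_mulVec,
      dotProduct_smul, smul_eq_mul, Matrix.sub_mulVec, dotProduct_sub] at hab
    simp only [Matrix.gram_apply, f, g, WithLp.prod_inner_apply, inner_conjColumn,
      EuclideanSpace.inner_toLp_toLp,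
      conjTranspose_mulVec_dotProduct_star]
    rw [← hab]
    field_simp
    ring
  obtain ⟨V, hV, hVf⟩ := exists_contraction_of_gram_eq f g hfg
  obtain ⟨s, hs, hsV⟩ := exists_transferFunction V hV
  refine ⟨s, hs, fun z => ?_⟩
  classical
  rw [← Matrix.conjTranspose_inj]
  refine Matrix.ext_of_mulVec_single fun i => ?_
  rw [Matrix.conjTranspose_mul, ← Matrix.mulVec_mulVec]
  -- `V f = g` says that input `T(z)* u` with state `v (z, u)` produces output `R(z)* u`, so
  -- `s(β(z))* T(z)* u = R(z)* u`.
  exact (hsV _ _ _ _ (hVf (z, Pi.single i 1))).symm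

/-! ### Rank-one perturbations of the identity and their square roots -/

section RankOne

variable {n : Type*} [Fintype n] [DecidableEq n]

theorem one_add_smul_vecMulVec_mul (v : n → ℂ) (c d : ℂ) (h : c + d + c * d * (star v ⬝ᵥ v) = 0) :
    (1 + c • Matrix.vecMulVec v (star v)) * (1 + d • Matrix.vecMulVec v (star v)) = 1 := by
  rw [add_mul, mul_add, mul_add, Matrix.smul_mul, Matrix.mul_smul, Matrix.smul_mul,
    Matrix.mul_smul, Matrix.vecMulVec_mul_vecMulVec, one_mul, mul_one, one_mul]
  rw [add_assoc, add_eq_left]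
  ext i j
  simp only [Matrix.add_apply, Matrix.smul_apply, Matrix.vecMulVec_apply, Pi.smul_apply,
    smul_eq_mul, Matrix.zero_apply]
  linear_combination (v i * star v j) * h

theorem posSemidef_one_add_smul_vecMulVec (v : n → ℂ) {c : ℝ} (hc : 0 ≤ c) :
    (1 + (c : ℂ) • Matrix.vecMulVec v (star v)).PosSemidef :=
  Matrix.PosSemidef.one.add
    ((Matrix.posSemidef_vecMulVec_self_star v).smul (a := (c : ℂ)) (by exact_mod_cast hc))

/-- Lets later computations avoid an explicit square root: the square of its inverse suffices. -/
theorem Matrix.PosSemidef.sqrt_inv_mul_self {A B : Matrix n n ℂ} (hA : A.PosSemidef)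
    (hAB : A * B = 1) :
    IsUnit (CFC.sqrt A) ∧ (CFC.sqrt A)⁻¹ * (CFC.sqrt A)⁻¹ = B := by
  have hQ : CFC.sqrt A * CFC.sqrt A = A := CFC.sqrt_mul_sqrt_self A hA.nonneg
  constructor
  · exact IsUnit.of_mul_eq_one (CFC.sqrt A * B) (by rw [← mul_assoc, hQ, hAB])
  · rw [← Matrix.mul_inv_rev, hQ]
    exact Matrix.inv_eq_right_inv hAB

theorem Matrix.conjTranspose_sqrt (A : Matrix n n ℂ) :
    (CFC.sqrt A).conjTranspose = CFC.sqrt A :=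
  (Matrix.nonneg_iff_posSemidef.1 (CFC.sqrt_nonneg A)).isHermitian

end RankOne

/-! ### The Blaschke identity -/

section Blaschke

variable {N : ℕ}

theorem one_sub_inner_blaschke (a l m : OpenBall N) :
    1 - ⟪blaschke a m, blaschke a l⟫_ℂ =
      (1 - ⟪a.1, a.1⟫_ℂ) * (1 - ⟪m.1, l.1⟫_ℂ) /
        ((1 - ⟪a.1, l.1⟫_ℂ) * (1 - ⟪m.1, a.1⟫_ℂ)) := by
  have ha : ‖a.1‖ < 1 := mem_ball_zero_iff.1 a.2
  have ht : 0 < 1 - ‖a.1‖ ^ 2 := by nlinarith [norm_nonneg a.1]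
  have haa : ⟪a.1, a.1⟫_ℂ = ((‖a.1‖ ^ 2 : ℝ) : ℂ) := by
    rw [inner_self_eq_norm_sq_to_K]; norm_cast
  have ht0 := OpenBall.one_sub_inner_ne_zero a a
  have hla := OpenBall.one_sub_inner_ne_zero a l
  have hma := OpenBall.one_sub_inner_ne_zero m a
  have hdot : star (star a.1.ofLp) ⬝ᵥ star a.1.ofLp = ⟪a.1, a.1⟫_ℂ := by
    rw [star_star]; rfl
  set P := Matrix.vecMulVec (star a.1.ofLp) a.1.ofLp with hP
  set c : ℝ := (1 - ‖a.1‖ ^ 2)⁻¹ with hc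
  have hcC : (c : ℂ) = (1 - ⟪a.1, a.1⟫_ℂ)⁻¹ := by rw [hc, haa]; push_cast; rfl
  have hPstar : P = Matrix.vecMulVec (star a.1.ofLp) (star (star a.1.ofLp)) := by rw [star_star]
  have hinv : (1 - P) * (1 + (c : ℂ) • P) = 1 := by
    have h := one_add_smul_vecMulVec_mul (star a.1.ofLp) (-1) c (by
      rw [hdot, hcC]
      field_simp
      ring)
    rw [← hPstar] at h
    rwa [neg_one_smul, ← sub_eq_add_neg] at h
  -- Positivity is inherited from the inverse `1 + c P`, where it is evident.
  have hpos : (1 - P).PosSemidef := by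
    have h := (posSemidef_one_add_smul_vecMulVec (star a.1.ofLp) (inv_nonneg.2 ht.le)).inv
    rw [← hPstar, ← hc, Matrix.inv_eq_left_inv hinv] at h
    exact h
  obtain ⟨-, hQ⟩ := hpos.sqrt_inv_mul_self hinv
  have hQh : ((CFC.sqrt (1 - P))⁻¹).conjTranspose = (CFC.sqrt (1 - P))⁻¹ := by
    rw [Matrix.conjTranspose_nonsing_inv, Matrix.conjTranspose_sqrt]
  have hdotQ (x y : Fin N → ℂ) :
      Matrix.vecMul x (CFC.sqrt (1 - P))⁻¹ ⬝ᵥ star (Matrix.vecMul y (CFC.sqrt (1 - P))⁻¹) =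
        x ⬝ᵥ star y + c * ((x ⬝ᵥ star a.1.ofLp) * (a.1.ofLp ⬝ᵥ star y)) := by
    rw [Matrix.star_vecMul, ← Matrix.dotProduct_mulVec, Matrix.mulVec_mulVec, hQh, hQ,
      Matrix.add_mulVec, Matrix.one_mulVec, Matrix.smul_mulVec, hP, Matrix.vecMulVec_mulVec,
      dotProduct_add, dotProduct_smul, dotProduct_smul]
    simp [mul_comm]
  have hin (x y : EuclideanSpace ℂ (Fin N)) : ⟪x, y⟫_ℂ = y.ofLp ⬝ᵥ star x.ofLp := rfl
  have hsq : ((Real.sqrt (1 - ‖a.1‖ ^ 2) : ℝ) : ℂ) * (Real.sqrt (1 - ‖a.1‖ ^ 2) : ℝ) =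
      1 - ⟪a.1, a.1⟫_ℂ := by
    rw [← Complex.ofReal_mul, Real.mul_self_sqrt ht.le, haa]
    push_cast; rfl
  have hconj : (starRingEnd ℂ) (1 - ⟪a.1, m.1⟫_ℂ) = 1 - ⟪m.1, a.1⟫_ℂ := by
    rw [map_sub, map_one, inner_conj_symm]
  rw [hin (blaschke a m), blaschke, blaschke]
  simp only [star_smul, smul_dotProduct, dotProduct_smul, ← hP, hdotQ, RCLike.star_def, map_div₀,
    hconj, Complex.conj_ofReal, smul_eq_mul, hcC]
  simp only [WithLp.ofLp_sub, star_sub, sub_dotProduct, dotProduct_sub]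
  simp only [← hin]
  set s := ((Real.sqrt (1 - ‖a.1‖ ^ 2) : ℝ) : ℂ)
  have hs2 : s ^ 2 = 1 - ⟪a.1, a.1⟫_ℂ := by rw [sq, hsq]
  field_simp
  rw [hs2]
  ring

end Blaschke

/-! ### The matrix `D` and the adapted unitary -/

section RootD

variable {p q : ℕ} (ξ : Fin p → ℂ) (η : Fin q → ℂ)

theorem ofReal_cJc : ((cJc ξ η : ℝ) : ℂ) = star ξ ⬝ᵥ ξ - star η ⬝ᵥ η := by
  have h : 0 ≤ star ξ ⬝ᵥ ξ := dotProduct_star_self_nonneg ξ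
  have h' : 0 ≤ star η ⬝ᵥ η := dotProduct_star_self_nonneg η
  apply Complex.ext
  · simp [cJc]
  · rw [Complex.nonneg_iff] at h h'
    rw [Complex.sub_im, ← h.2, ← h'.2]
    simp

variable {ξ η}

theorem star_dotProduct_self_ne_zero_of_cJc_pos (h : 0 < cJc ξ η) : star ξ ⬝ᵥ ξ ≠ 0 := by
  intro h0
  have hη : 0 ≤ star η ⬝ᵥ η := dotProduct_star_self_nonneg η
  have : cJc ξ η = -(star η ⬝ᵥ η).re := by simp [cJc, h0]
  linarith [(Complex.nonneg_iff.1 hη).1]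

theorem rootD_mul_self (h : 0 < cJc ξ η) :
    rootD ξ η * rootD ξ η = 1 + ((cJc ξ η : ℝ) : ℂ)⁻¹ • Matrix.vecMulVec η (star η) := by
  have hp := posSemidef_one_add_smul_vecMulVec η (inv_nonneg.2 h.le)
  rw [Complex.ofReal_inv] at hp
  exact CFC.sqrt_mul_sqrt_self _ hp.nonneg

/-- Sherman–Morrison: the denominator is `κ + η*η = ξ*ξ`. -/
theorem isUnit_rootD_and_inv_mul_inv (h : 0 < cJc ξ η) :
    IsUnit (rootD ξ η) ∧
      (rootD ξ η)⁻¹ * (rootD ξ η)⁻¹ = 1 - (star ξ ⬝ᵥ ξ)⁻¹ • Matrix.vecMulVec η (star η) := by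
  have hp := posSemidef_one_add_smul_vecMulVec η (inv_nonneg.2 h.le)
  rw [Complex.ofReal_inv] at hp
  refine hp.sqrt_inv_mul_self ?_
  have hX := star_dotProduct_self_ne_zero_of_cJc_pos h
  have hk : ((cJc ξ η : ℝ) : ℂ) ≠ 0 := by exact_mod_cast h.ne'
  rw [sub_eq_add_neg, ← neg_smul]
  apply one_add_smul_vecMulVec_mul
  rw [ofReal_cJc] at hk ⊢
  field_simp
  ring

theorem conjTranspose_rootD : (rootD ξ η).conjTranspose = rootD ξ η :=
  Matrix.conjTranspose_sqrt _

theorem ofReal_sqrt_cJc_mul_self (h : 0 < cJc ξ η) :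
    ((Real.sqrt (cJc ξ η) : ℝ) : ℂ) * (Real.sqrt (cJc ξ η) : ℝ) = (cJc ξ η : ℝ) := by
  rw [← Complex.ofReal_mul, Real.mul_self_sqrt h.le]

end RootD

namespace IsAdaptedUnitary

variable {r : ℕ} {ξ : Fin (r + 1) → ℂ} {U : Matrix (Fin (r + 1)) (Fin (r + 1)) ℂ}

theorem apply_last (hU : IsAdaptedUnitary ξ U) (i : Fin (r + 1)) :
    U i (Fin.last r) = ((Real.sqrt (star ξ ⬝ᵥ ξ).re : ℝ) : ℂ)⁻¹ * ξ i :=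
  congrFun hU.2 i

theorem sqrt_mul_self (ξ : Fin (r + 1) → ℂ) :
    ((Real.sqrt (star ξ ⬝ᵥ ξ).re : ℝ) : ℂ) * (Real.sqrt (star ξ ⬝ᵥ ξ).re : ℝ) = star ξ ⬝ᵥ ξ := by
  have h : 0 ≤ star ξ ⬝ᵥ ξ := dotProduct_star_self_nonneg ξ
  rw [← Complex.ofReal_mul, Real.mul_self_sqrt (Complex.nonneg_iff.1 h).1]
  exact Complex.ext rfl (Complex.nonneg_iff.1 h).2

theorem submatrix_mul_conjTranspose (hU : IsAdaptedUnitary ξ U) :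
    U.submatrix id Fin.castSucc * (U.submatrix id Fin.castSucc).conjTranspose =
      1 - (star ξ ⬝ᵥ ξ)⁻¹ • Matrix.vecMulVec ξ (star ξ) := by
  have h : U * U.conjTranspose = 1 := Matrix.mem_unitaryGroup_iff.1 hU.1
  ext i j
  have hij := congrFun (congrFun h i) j
  rw [Matrix.mul_apply, Fin.sum_univ_castSucc, Matrix.conjTranspose_apply, hU.apply_last,
    hU.apply_last] at hij
  rw [Matrix.sub_apply, ← hij, ← sqrt_mul_self, Matrix.mul_apply]
  simp [Matrix.vecMulVec_apply]
  ring

theorem star_dotProduct_submatrix_mulVec (hU : IsAdaptedUnitary ξ U) (x : Fin r → ℂ) :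
    star ξ ⬝ᵥ (U.submatrix id Fin.castSucc).mulVec x = 0 := by
  by_cases hξ : star ξ ⬝ᵥ ξ = 0
  · simp [dotProduct_star_self_eq_zero.1 hξ]
  have h : U.conjTranspose * U = 1 := Matrix.mem_unitaryGroup_iff'.1 hU.1
  have hs : ((Real.sqrt (star ξ ⬝ᵥ ξ).re : ℝ) : ℂ) ≠ 0 := fun h0 => by
    have := sqrt_mul_self ξ
    rw [h0, mul_zero] at this
    exact hξ this.symm
  rw [Matrix.dotProduct_mulVec]
  convert zero_dotProduct x
  ext k
  have hk := congrFun (congrFun h (Fin.last r)) k.castSucc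
  simp only [Matrix.mul_apply, Matrix.conjTranspose_apply, hU.apply_last, star_mul'] at hk
  rw [Matrix.one_apply_ne (Fin.castSucc_lt_last k).ne'] at hk
  simp_rw [mul_assoc] at hk
  rw [← Finset.mul_sum] at hk
  have h2 := (mul_eq_zero.1 hk).resolve_left (by simpa using hs)
  simpa [Matrix.vecMul, dotProduct] using h2

end IsAdaptedUnitary

/-! ### The linear fractional transformation -/

section Interpolation

variable {N r q : ℕ} {ξ : Fin (r + 1) → ℂ} {η : Fin q → ℂ}
  {U : Matrix (Fin (r + 1)) (Fin (r + 1)) ℂ}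

/-- The left factor of the Leech factorization attached to the linear fractional
transformation. -/
noncomputable def leechLeft (ξ : Fin (r + 1) → ℂ) (η : Fin q → ℂ) (U : Matrix (Fin (r + 1)) (Fin (r + 1)) ℂ)
    (b : EuclideanSpace ℂ (Fin N)) (s : Matrix (Fin (r + 1)) (Fin q) ℂ) :
    Matrix (Fin (r + 1)) (Fin N ⊕ Fin r) ℂ :=
  Matrix.fromCols (((Real.sqrt (cJc ξ η) : ℝ) : ℂ)⁻¹ • Matrix.vecMulVec (ξ - s.mulVec η) b.ofLp)
    (U.submatrix id Fin.castSucc)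

/-- The product in the Leech factorization attached to the linear fractional transformation. -/
noncomputable def leechRight (ξ : Fin (r + 1) → ℂ) (η : Fin q → ℂ) (s : Matrix (Fin (r + 1)) (Fin q) ℂ) :
    Matrix (Fin (r + 1)) (Fin q) ℂ :=
  s * rootD ξ η - (((cJc ξ η : ℝ) : ℂ)⁻¹ • Matrix.vecMulVec ξ (star η)) * (rootD ξ η)⁻¹

theorem leechRight_mul_conjTranspose (h : 0 < cJc ξ η) (s t : Matrix (Fin (r + 1)) (Fin q) ℂ) :
    leechRight ξ η s * (leechRight ξ η t).conjTranspose =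
      s * t.conjTranspose
        + ((cJc ξ η : ℝ) : ℂ)⁻¹ • (Matrix.vecMulVec (s.mulVec η) (star (t.mulVec η))
          - Matrix.vecMulVec (s.mulVec η) (star ξ) - Matrix.vecMulVec ξ (star (t.mulVec η)))
        + (((cJc ξ η : ℝ) : ℂ)⁻¹ - (star ξ ⬝ᵥ ξ)⁻¹) • Matrix.vecMulVec ξ (star ξ) := by
  obtain ⟨hD, hDi⟩ := isUnit_rootD_and_inv_mul_inv h
  have hDD := rootD_mul_self h
  have hdet := (Matrix.isUnit_iff_isUnit_det _).1 hD
  have hX := star_dotProduct_self_ne_zero_of_cJc_pos h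
  have hk : ((cJc ξ η : ℝ) : ℂ) ≠ 0 := by exact_mod_cast h.ne'
  have hkX := ofReal_cJc ξ η
  have hDh : (rootD ξ η).conjTranspose = rootD ξ η := conjTranspose_rootD
  have hR (s : Matrix (Fin (r + 1)) (Fin q) ℂ) : leechRight ξ η s = s * rootD ξ η -
      ((cJc ξ η : ℝ) : ℂ)⁻¹ • (Matrix.vecMulVec ξ (star η) * (rootD ξ η)⁻¹) := by
    rw [leechRight, Matrix.smul_mul]
  have hstar : star (((cJc ξ η : ℝ) : ℂ)⁻¹) = ((cJc ξ η : ℝ) : ℂ)⁻¹ := by simp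
  set D := rootD ξ η
  set k := ((cJc ξ η : ℝ) : ℂ)
  -- Grouped so that `D` enters only through `D²`, `D⁻²` and `D D⁻¹ = 1`.
  have hexp : leechRight ξ η s * (leechRight ξ η t).conjTranspose =
      s * (D * D) * t.conjTranspose - k⁻¹ • (s * (D * D⁻¹) * Matrix.vecMulVec η (star ξ))
      - k⁻¹ • (Matrix.vecMulVec ξ (star η) * (D⁻¹ * D) * t.conjTranspose)
      + (k⁻¹ * k⁻¹) • (Matrix.vecMulVec ξ (star η) * (D⁻¹ * D⁻¹) * Matrix.vecMulVec η (star ξ)) := by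
    simp only [hR, Matrix.conjTranspose_sub, Matrix.conjTranspose_mul,
      Matrix.conjTranspose_smul, Matrix.conjTranspose_nonsing_inv, Matrix.conjTranspose_vecMulVec,
      star_star, hDh, hstar, Matrix.mul_sub, Matrix.sub_mul, Matrix.smul_mul,
      Matrix.mul_smul, smul_sub, smul_smul, Matrix.mul_assoc]
    abel
  rw [hexp, Matrix.mul_nonsing_inv _ hdet, Matrix.nonsing_inv_mul _ hdet, hDD, hDi]
  simp only [Matrix.mul_one, Matrix.mul_add, Matrix.add_mul, Matrix.mul_sub,
    Matrix.mul_smul, Matrix.smul_mul, Matrix.mul_vecMulVec, Matrix.vecMulVec_mul, Matrix.sub_mulVec,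
    Matrix.smul_mulVec, Matrix.smul_vecMulVec, Matrix.vecMulVec_mulVec, op_smul_eq_smul, Matrix.star_mulVec]
  ext i j
  simp only [Matrix.add_apply, Matrix.sub_apply, Matrix.smul_apply, Matrix.vecMulVec_apply,
    smul_eq_mul, Pi.sub_apply, Pi.smul_apply]
  have hY : star η ⬝ᵥ η = star ξ ⬝ᵥ ξ - k := by rw [hkX]; ring
  simp only [hY]
  field_simp
  ring

theorem leechLeft_mul_conjTranspose (h : 0 < cJc ξ η) (hU : IsAdaptedUnitary ξ U)
    (b c : EuclideanSpace ℂ (Fin N)) (s t : Matrix (Fin (r + 1)) (Fin q) ℂ) :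
    leechLeft ξ η U b s * (leechLeft ξ η U c t).conjTranspose =
      (((cJc ξ η : ℝ) : ℂ)⁻¹ * ⟪c, b⟫_ℂ) •
        Matrix.vecMulVec (ξ - s.mulVec η) (star (ξ - t.mulVec η))
      + (1 - (star ξ ⬝ᵥ ξ)⁻¹ • Matrix.vecMulVec ξ (star ξ)) := by
  rw [leechLeft, leechLeft, Matrix.conjTranspose_fromCols_eq_fromRows_conjTranspose,
    Matrix.fromCols_mul_fromRows, hU.submatrix_mul_conjTranspose, ← ofReal_sqrt_cJc_mul_self h]
  congr 1
  have hin : ⟪c, b⟫_ℂ = b.ofLp ⬝ᵥ star c.ofLp := rfl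
  rw [Matrix.conjTranspose_smul, Matrix.conjTranspose_vecMulVec, Matrix.smul_mul, Matrix.mul_smul,
    Matrix.vecMulVec_mul_vecMulVec, hin]
  ext i j
  simp only [Matrix.smul_apply, Matrix.vecMulVec_apply, Pi.smul_apply, smul_eq_mul, mul_inv]
  simp
  ring

/-- The `ξξ*/(ξ*ξ)` terms cancel, and the `κ⁻¹` terms of `leechRight` complete to `(ξ - sη)(ξ -
tη)*`. -/
theorem leechLeft_sub_leechRight (h : 0 < cJc ξ η) (hU : IsAdaptedUnitary ξ U)
    (b c : EuclideanSpace ℂ (Fin N)) (s t : Matrix (Fin (r + 1)) (Fin q) ℂ) :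
    leechLeft ξ η U b s * (leechLeft ξ η U c t).conjTranspose
        - leechRight ξ η s * (leechRight ξ η t).conjTranspose =
      1 - s * t.conjTranspose - (((cJc ξ η : ℝ) : ℂ)⁻¹ * (1 - ⟪c, b⟫_ℂ)) •
        Matrix.vecMulVec (ξ - s.mulVec η) (star (ξ - t.mulVec η)) := by
  rw [leechLeft_mul_conjTranspose h hU, leechRight_mul_conjTranspose h]
  ext i j
  simp only [Matrix.add_apply, Matrix.sub_apply, Matrix.smul_apply, Matrix.vecMulVec_apply,
    smul_eq_mul, star_sub, Pi.sub_apply]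
  ring

theorem lftNum_sub_mul_lftDen (b : EuclideanSpace ℂ (Fin N))
    (s : Matrix (Fin (r + 1)) (Fin q) ℂ) (σ : Matrix (Fin N ⊕ Fin r) (Fin q) ℂ) :
    lftNum ξ η U b σ - s * lftDen ξ η b σ = leechLeft ξ η U b s * σ - leechRight ξ η s := by
  obtain ⟨σ₁, σ₂, rfl⟩ : ∃ σ₁ σ₂, σ = Matrix.fromRows σ₁ σ₂ :=
    ⟨σ.toRows₁, σ.toRows₂, (Matrix.fromRows_toRows σ).symm⟩
  simp only [lftNum, lftDen, leechLeft, leechRight, Matrix.fromCols_mul_fromRows, Matrix.mul_add,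
    Matrix.zero_mul, add_zero, Matrix.smul_mul, Matrix.mul_smul, Matrix.vecMulVec_mul,
    Matrix.mul_vecMulVec, Matrix.sub_vecMulVec, smul_sub, Matrix.sub_mul]
  abel

/-- A kernel vector `x` of the denominator is also killed by the numerator. The first fact gives `D
x = -γη`; pairing the second with `ξ` removes `U'` and gives `γ + κ⁻¹η*D⁻¹x = 0`. Since `D⁻²η =
(κ/ξ*ξ)η`, together they force `γκ = 0`, hence `x = 0`. -/
theorem isUnit_lftDen (h : 0 < cJc ξ η) (hU : IsAdaptedUnitary ξ U)
    (b : EuclideanSpace ℂ (Fin N)) (s : Matrix (Fin (r + 1)) (Fin q) ℂ)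
    (σ : Matrix (Fin N ⊕ Fin r) (Fin q) ℂ)
    (hs : lftNum ξ η U b σ = s * lftDen ξ η b σ) : IsUnit (lftDen ξ η b σ) := by
  obtain ⟨hD, hDi⟩ := isUnit_rootD_and_inv_mul_inv h
  have hdet := (Matrix.isUnit_iff_isUnit_det _).1 hD
  have hX := star_dotProduct_self_ne_zero_of_cJc_pos h
  have hk : ((cJc ξ η : ℝ) : ℂ) ≠ 0 := by exact_mod_cast h.ne'
  have hkX := ofReal_cJc ξ η
  rw [← Matrix.mulVec_injective_iff_isUnit]
  refine (injective_iff_map_eq_zero (lftDen ξ η b σ).mulVecLin).2 fun x hx => ?_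
  rw [Matrix.mulVecLin_apply] at hx
  have hn : (lftNum ξ η U b σ).mulVec x = 0 := by
    rw [hs, ← Matrix.mulVec_mulVec, hx, Matrix.mulVec_zero]
  obtain ⟨σ₁, σ₂, rfl⟩ : ∃ σ₁ σ₂, σ = Matrix.fromRows σ₁ σ₂ :=
    ⟨σ.toRows₁, σ.toRows₂, (Matrix.fromRows_toRows σ).symm⟩
  set D := rootD ξ η
  set k := ((cJc ξ η : ℝ) : ℂ)
  set γ : ℂ := ((Real.sqrt (cJc ξ η) : ℝ) : ℂ)⁻¹ * (b.ofLp ⬝ᵥ σ₁.mulVec x) with hγ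
  have hx' : γ • η + D.mulVec x = 0 := by
    rw [← hx]
    simp only [lftDen, Matrix.fromCols_mul_fromRows, Matrix.zero_mul, add_zero, Matrix.add_mulVec,
      Matrix.smul_mul, Matrix.smul_mulVec, ← Matrix.mulVec_mulVec, Matrix.vecMulVec_mulVec, hγ,
      mul_smul, op_smul_eq_smul, D]
  have hn' : star ξ ⬝ᵥ ξ * (γ + k⁻¹ * (star η ⬝ᵥ D⁻¹.mulVec x)) = 0 := by
    have h0 : star ξ ⬝ᵥ (lftNum ξ η U b (Matrix.fromRows σ₁ σ₂)).mulVec x = 0 := by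
      rw [hn, dotProduct_zero]
    rw [← h0]
    simp only [lftNum, Matrix.fromCols_mul_fromRows, Matrix.add_mulVec,
      Matrix.smul_mul, Matrix.smul_mulVec, ← Matrix.mulVec_mulVec, Matrix.vecMulVec_mulVec,
      op_smul_eq_smul, dotProduct_add, dotProduct_smul, hU.star_dotProduct_submatrix_mulVec,
      smul_eq_mul, hγ]
    ring
  have hDx : star η ⬝ᵥ D⁻¹.mulVec x = -γ * (star η ⬝ᵥ η) * k * (star ξ ⬝ᵥ ξ)⁻¹ := by
    have h1 : x = D⁻¹.mulVec (D.mulVec x) := by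
      rw [Matrix.mulVec_mulVec, Matrix.nonsing_inv_mul _ hdet, Matrix.one_mulVec]
    rw [h1, eq_neg_of_add_eq_zero_right hx', Matrix.mulVec_mulVec, hDi, Matrix.sub_mulVec,
      Matrix.one_mulVec, Matrix.smul_mulVec, Matrix.vecMulVec_mulVec]
    simp only [op_smul_eq_smul, dotProduct_sub, dotProduct_smul, dotProduct_neg, smul_eq_mul]
    rw [hkX]
    field_simp
    ring
  have hγ0 : γ = 0 := by
    have h2 := (mul_eq_zero.1 hn').resolve_left hX
    rw [hDx] at h2
    have h3 : γ * k = 0 := by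
      field_simp at h2
      rw [hkX]
      linear_combination h2
    exact (mul_eq_zero.1 h3).resolve_right hk
  rw [hγ0, zero_smul, zero_add] at hx'
  rw [← Matrix.one_mulVec x, ← Matrix.nonsing_inv_mul D hdet, ← Matrix.mulVec_mulVec, hx',
    Matrix.mulVec_zero]

/-- The Schur complement of the de Branges-Rovnyak kernel with respect to one of its values is
again a positive kernel. -/
theorem isPositiveKernel_sub_rankOne {Ω : Type*} (β : Ω → OpenBall N)
    (S : Ω → Matrix (Fin (r + 1)) (Fin q) ℂ) (hS : IsSchurMultiplier (kernelBeta β) S)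
    (w₀ : Ω) (hη : η = (S w₀).conjTranspose.mulVec ξ) :
    IsPositiveKernel fun z w => kernelBeta β z w • (1 - S z * (S w).conjTranspose -
      (((cJc ξ η : ℝ) : ℂ)⁻¹ * (1 - ⟪blaschke (β w₀) (β w), blaschke (β w₀) (β z)⟫_ℂ)) •
        Matrix.vecMulVec (ξ - (S z).mulVec η) (star (ξ - (S w).mulVec η))) := by
  rw [isPositiveKernel_iff]
  -- The pivot entry is `κ K_β(w₀,w₀)`; the Blaschke identity absorbs the quotient of kernel values.
  have h := (isPositiveKernel_iff.1 hS).schurComplement (w₀, ξ)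
  refine Eq.mpr (congrArg Matrix.PosSemidef ?_) h
  have h1 (z) : (S z * (S w₀).conjTranspose).mulVec ξ = (S z).mulVec η := by
    rw [hη, Matrix.mulVec_mulVec]
  have h2 (w) (v) : star ξ ⬝ᵥ (S w₀ * (S w).conjTranspose).mulVec v =
      star ((S w).mulVec η) ⬝ᵥ v := by
    rw [Matrix.dotProduct_mulVec, hη, Matrix.mulVec_mulVec, Matrix.star_mulVec,
      Matrix.conjTranspose_mul, Matrix.conjTranspose_conjTranspose]
  have h3 : star ξ ⬝ᵥ (S w₀).mulVec η = star η ⬝ᵥ η := by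
    rw [Matrix.dotProduct_mulVec]
    congr 1
    rw [hη, Matrix.star_mulVec, Matrix.conjTranspose_conjTranspose]
  ext ⟨z, u⟩ ⟨w, v⟩
  have e1 := OpenBall.one_sub_inner_ne_zero (β w) (β z)
  have e2 := OpenBall.one_sub_inner_ne_zero (β w₀) (β z)
  have e3 := OpenBall.one_sub_inner_ne_zero (β w) (β w₀)
  have e4 := OpenBall.one_sub_inner_ne_zero (β w₀) (β w₀)
  simp only [kernelMatrix, Matrix.of_apply, kernelBeta, Matrix.smul_mulVec, dotProduct_smul,
    Matrix.sub_mulVec, Matrix.one_mulVec, dotProduct_sub, Matrix.vecMulVec_mulVec, smul_eq_mul,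
    op_smul_eq_smul, h1, h2, h3, one_sub_inner_blaschke, ← ofReal_cJc, star_sub, sub_dotProduct]
  field_simp

end Interpolation

/-! ### The norm estimate and the main theorem -/

theorem cJc_pos_of_strict {r q : ℕ} {s : Matrix (Fin (r + 1)) (Fin q) ℂ} {ξ : Fin (r + 1) → ℂ}
    {η : Fin q → ℂ} (hη : η = s.conjTranspose.mulVec ξ)
    (hξ : star ξ ⬝ᵥ (s * s.conjTranspose).mulVec ξ < star ξ ⬝ᵥ ξ) : 0 < cJc ξ η := by
  rw [← conjTranspose_mulVec_dotProduct_star, ← hη, dotProduct_comm, ← sub_pos] at hξ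
  exact (Complex.pos_iff.1 hξ).1

/-- Put `d = ξ*ξ - ξ*sη`. Expanding `D² = 1 + ηη*/κ` and using `ξ*sη - η*η = κ - d`, the terms
linear in `d` cancel. -/
theorem norm_sq_vecMul_rootD {r q : ℕ} {ξ : Fin (r + 1) → ℂ} {η : Fin q → ℂ} (h : 0 < cJc ξ η)
    (s : Matrix (Fin (r + 1)) (Fin q) ℂ) :
    ((‖(WithLp.toLp 2 (Matrix.vecMul (Matrix.vecMul (star ξ) s - star η) (rootD ξ η)) :
        EuclideanSpace ℂ (Fin q))‖ ^ 2 : ℝ) : ℂ) =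
      star ξ ⬝ᵥ (s * s.conjTranspose).mulVec ξ - star ξ ⬝ᵥ ξ +
        ((cJc ξ η : ℝ) : ℂ)⁻¹ * ((star ξ ⬝ᵥ ξ - star ξ ⬝ᵥ s.mulVec η) *
          star (star ξ ⬝ᵥ ξ - star ξ ⬝ᵥ s.mulVec η)) := by
  have hk : ((cJc ξ η : ℝ) : ℂ) ≠ 0 := by exact_mod_cast h.ne'
  have hkX := ofReal_cJc ξ η
  have hstar {n : ℕ} (x y : Fin n → ℂ) : star (star x ⬝ᵥ y) = star y ⬝ᵥ x := by
    rw [Matrix.star_dotProduct, star_star]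
  have hn (w : Fin q → ℂ) : ((‖(WithLp.toLp 2 w : EuclideanSpace ℂ (Fin q))‖ ^ 2 : ℝ) : ℂ) =
      w ⬝ᵥ star w := by
    rw [← EuclideanSpace.inner_toLp_toLp, inner_self_eq_norm_sq_to_K]
    norm_cast
  have h1 : star (Matrix.vecMul (star ξ) s) = s.conjTranspose.mulVec ξ := by
    rw [Matrix.star_vecMul, star_star]
  have h2 : star ξ ⬝ᵥ (s * s.conjTranspose).mulVec ξ =
      Matrix.vecMul (star ξ) s ⬝ᵥ s.conjTranspose.mulVec ξ := by
    rw [← Matrix.dotProduct_mulVec, Matrix.mulVec_mulVec]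
  have h3 : star η ⬝ᵥ s.conjTranspose.mulVec ξ = star (star ξ ⬝ᵥ s.mulVec η) := by
    rw [hstar, Matrix.dotProduct_mulVec, ← Matrix.star_mulVec]
  rw [hn, Matrix.star_vecMul, conjTranspose_rootD, ← Matrix.dotProduct_mulVec,
    Matrix.mulVec_mulVec, rootD_mul_self h]
  simp only [Matrix.add_mulVec, Matrix.one_mulVec, Matrix.smul_mulVec, Matrix.vecMulVec_mulVec,
    op_smul_eq_smul, dotProduct_add, dotProduct_smul, star_sub, star_star, h1, h2, dotProduct_sub,
    sub_dotProduct, smul_eq_mul, h3, ← Matrix.dotProduct_mulVec (star ξ) s η, hstar ξ ξ]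
  field_simp
  rw [hkX]
  ring

theorem norm_vecMul_rootD_le {Ω : Type*} {N r q : ℕ} (β : Ω → OpenBall N)
    (S : Ω → Matrix (Fin (r + 1)) (Fin q) ℂ) (hS : IsSchurMultiplier (kernelBeta β) S)
    (w₀ : Ω) {ξ : Fin (r + 1) → ℂ} {η : Fin q → ℂ} (hη : η = (S w₀).conjTranspose.mulVec ξ)
    (h : 0 < cJc ξ η) (z : Ω) :
    ‖(WithLp.toLp 2 (Matrix.vecMul (Matrix.vecMul (star ξ) (S z) - star η) (rootD ξ η)) :
        EuclideanSpace ℂ (Fin q))‖ ≤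
      ‖star ξ ⬝ᵥ ξ - star ξ ⬝ᵥ (S z).mulVec η‖ / Real.sqrt (cJc ξ η) *
        ‖blaschke (β w₀) (β z)‖ := by
  -- At one point this is `K_β(z,z)(κ⁻¹|d|²‖b‖² - W²) ≥ 0`.
  have hpos := isPositiveKernel_sub_rankOne β S hS w₀ hη 1 (fun _ => z) (fun _ => ξ)
  have hW := norm_sq_vecMul_rootD h (S z)
  set W := ‖(WithLp.toLp 2 (Matrix.vecMul (Matrix.vecMul (star ξ) (S z) - star η) (rootD ξ η)) :
        EuclideanSpace ℂ (Fin q))‖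
  set d := star ξ ⬝ᵥ ξ - star ξ ⬝ᵥ (S z).mulVec η with hd
  set b := blaschke (β w₀) (β z)
  have hz : 0 < 1 - ‖(β z).1‖ ^ 2 := by
    have := mem_ball_zero_iff.1 (β z).2
    nlinarith [norm_nonneg (β z).1]
  have hkz : kernelBeta β z z = (((1 - ‖(β z).1‖ ^ 2)⁻¹ : ℝ) : ℂ) := by
    rw [kernelBeta, inner_self_eq_norm_sq_to_K, one_div]
    push_cast
    rfl
  have hstar : star (ξ - (S z).mulVec η) ⬝ᵥ ξ = star d := by
    rw [hd, ← dotProduct_sub, Matrix.star_dotProduct]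
  have hdd : d * star d = ((‖d‖ ^ 2 : ℝ) : ℂ) := by
    rw [RCLike.star_def, RCLike.mul_conj]
    norm_cast
  have hbb : ⟪b, b⟫_ℂ = ((‖b‖ ^ 2 : ℝ) : ℂ) := by
    rw [inner_self_eq_norm_sq_to_K]; norm_cast
  simp only [Finset.univ_unique, Finset.sum_singleton, Matrix.smul_mulVec, Matrix.sub_mulVec,
    Matrix.one_mulVec, dotProduct_smul, dotProduct_sub, Matrix.vecMulVec_mulVec, op_smul_eq_smul,
    hstar, smul_eq_mul, ← hd] at hpos
  have hfin : kernelBeta β z z * (star ξ ⬝ᵥ ξ - star ξ ⬝ᵥ (S z * (S z).conjTranspose).mulVec ξ -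
      ((cJc ξ η : ℝ) : ℂ)⁻¹ * (1 - ⟪b, b⟫_ℂ) * (star d * d)) =
      (((1 - ‖(β z).1‖ ^ 2)⁻¹ * ((cJc ξ η)⁻¹ * ‖d‖ ^ 2 * ‖b‖ ^ 2 - W ^ 2) : ℝ) : ℂ) := by
    rw [hkz, Complex.ofReal_mul, Complex.ofReal_sub, hW, hdd, hbb, mul_comm (star d), hdd]
    push_cast
    ring
  rw [hfin] at hpos
  have hpos' := Complex.zero_le_real.1 hpos
  have hsq : W ^ 2 ≤ (‖d‖ / Real.sqrt (cJc ξ η) * ‖b‖) ^ 2 := by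
    rw [mul_pow, div_pow, Real.sq_sqrt h.le, div_eq_inv_mul]
    linarith [(mul_nonneg_iff_of_pos_left (inv_pos.2 hz)).1 hpos']
  exact (sq_le_sq₀ (norm_nonneg _) (by positivity)).1 hsq

theorem mainTheorem4 {Ω : Type*} {N r q : ℕ} (β : Ω → OpenBall N)
    (S : Ω → Matrix (Fin (r + 1)) (Fin q) ℂ) (hS : IsSchurMultiplier (kernelBeta β) S)
    (w₀ : Ω) (ξ : Fin (r + 1) → ℂ) (η : Fin q → ℂ)
    (hη : η = (S w₀).conjTranspose.mulVec ξ)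
    (hξ : star ξ ⬝ᵥ (S w₀ * (S w₀).conjTranspose).mulVec ξ < star ξ ⬝ᵥ ξ) :
    (∃ G : OpenBall N → Matrix (Fin (r + 1)) (Fin q) ℂ,
      IsSchurMultiplier (druryArveson N) G ∧ ∀ z, S z = G (β z)) ∧
    (∀ U : Matrix (Fin (r + 1)) (Fin (r + 1)) ℂ, IsAdaptedUnitary ξ U →
      ∃ s : OpenBall N → Matrix (Fin N ⊕ Fin r) (Fin q) ℂ,
        IsSchurMultiplier (druryArveson N) s ∧
        IsSchurMultiplier (kernelBeta β) (fun z => s (β z)) ∧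
        ∀ z : Ω,
          IsUnit (lftDen ξ η (blaschke (β w₀) (β z)) (s (β z))) ∧
          S z = lftNum ξ η U (blaschke (β w₀) (β z)) (s (β z)) *
            (lftDen ξ η (blaschke (β w₀) (β z)) (s (β z)))⁻¹) ∧
    (∀ z : Ω,
      ‖(WithLp.toLp 2 (Matrix.vecMul (Matrix.vecMul (star ξ) (S z) - star η) (rootD ξ η)) :
          EuclideanSpace ℂ (Fin q))‖ ≤
        ‖star ξ ⬝ᵥ ξ - star ξ ⬝ᵥ (S z).mulVec η‖ / Real.sqrt (cJc ξ η) *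
          ‖blaschke (β w₀) (β z)‖) := by
  have hk := cJc_pos_of_strict hη hξ
  refine ⟨?_, fun U hU => ?_, norm_vecMul_rootD_le β S hS w₀ hη hk⟩
  · obtain ⟨G, hG, hGS⟩ := exists_schurMultiplier_mul_eq β
      (fun _ => (1 : Matrix (Fin (r + 1)) (Fin (r + 1)) ℂ)) S (by
        simp only [Matrix.conjTranspose_one, Matrix.mul_one]
        exact hS)
    exact ⟨G, hG, fun z => by rw [← hGS z, Matrix.one_mul]⟩
  · obtain ⟨s, hs, hsR⟩ := exists_schurMultiplier_mul_eq β
      (fun z => leechLeft ξ η U (blaschke (β w₀) (β z)) (S z)) (fun z => leechRight ξ η (S z)) (by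
        simp only [leechLeft_sub_leechRight hk hU]
        exact isPositiveKernel_sub_rankOne β S hS w₀ hη)
    -- Positivity for `K_β` is positivity of the Drury-Arveson kernel sampled at the points `β(x
    -- i)`.
    refine ⟨s, hs, fun n x u => hs n (fun i => β (x i)) u, fun z => ?_⟩
    have hnum : lftNum ξ η U (blaschke (β w₀) (β z)) (s (β z)) =
        S z * lftDen ξ η (blaschke (β w₀) (β z)) (s (β z)) := by
      rw [← sub_eq_zero, lftNum_sub_mul_lftDen, hsR, sub_self]
    have hunit := isUnit_lftDen hk hU _ _ _ hnum
    refine ⟨hunit, ?_⟩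
    rw [hnum, Matrix.mul_nonsing_inv_cancel_right _ _ ((Matrix.isUnit_iff_isUnit_det _).1 hunit)]
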